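/- For every integer $\Delta \ge 2$ there exists a constant $C = C(\Delta) > 0$ such that the following holds. Let $\beta = \beta(n)$ and $\varepsilon = \varepsilon(n)$ be real sequences such that, for all sufficiently large $n$, $$0 < \beta \le \log n, \qquad \varepsilon > 0, \qquad \beta \ge \frac{C}{\varepsilon}\log\frac1\varepsilon \qquad\text{and}\qquad \beta \ge C$$ (the last condition follows from the previous one whenever $\varepsilon \le 1/2$, and it holds for all large $n$ whenever $\beta \to \infty$). Let $G(n,p)$ denote the random graph on $n$ labelled vertices in which each pair of vertices is an edge independently with probability $p$. Then the probability that $G(n,\beta/n)$ contains, simultaneously, every tree with maximum degree at most $\Delta$ on at most $(1-\varepsilon)n$ vertices as a (not necessarily induced) subgraph tends to $1$ as $n \to \infty$. -/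

import Mathlib

/-- The binomial random graph `G(n, p)` on the vertex set `Fin n`, as a law on simple graphs.
The edge probability is a real number; values outside `[0, 1]` are moved to the nearest endpoint. -/
noncomputable def gnp (n : ℕ) (p : ℝ) : MeasureTheory.Measure (SimpleGraph (Fin n)) :=
  SimpleGraph.binomialRandom (Fin n) (Set.projIcc (0 : ℝ) 1 zero_le_one p)

/-- For each `n`, let `μ n` be the law of a random graph on `n` vertices and `P n` a property of
graphs on `n` vertices. `P` holds asymptotically almost surely if the probability of `P n` tends to
`1` as `n` tends to infinity. -/
def HoldsAAS (μ : ∀ n : ℕ, MeasureTheory.Measure (SimpleGraph (Fin n)))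
    (P : ∀ n : ℕ, SimpleGraph (Fin n) → Prop) : Prop :=
  Filter.Tendsto (fun n => μ n {G | P n G}) Filter.atTop (nhds 1)

/-- `G` contains, as a (not necessarily induced) subgraph, every tree with maximum degree at most
`Δ` on at most `m` vertices. -/
def ContainsBoundedDegreeTrees {V : Type*} (G : SimpleGraph V) (Δ : ℕ) (m : ℝ) : Prop :=
  ∀ (k : ℕ) (T : SimpleGraph (Fin k)) [DecidableRel T.Adj],
    T.IsTree → T.maxDegree ≤ Δ → (k : ℝ) ≤ m → T.IsContained G

/-!
The random graph enters only through one property: with high probability, any two disjoint sets of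
`m` vertices span an edge (`SimpleGraph.IsJoined`), where `m` is about `min ε (1 / 2) * n / (3 Δ +
10)`. This is a union bound over pairs of `m`-sets (`SimpleGraph.binomialRandom_not_isJoined_le`):
there are at most `(e n / m) ^ (2 m)` pairs, each fails to span an edge with probability at most
`exp (-β m² / n)`, and `β ≥ (C / ε) log (1 / ε)` is what makes `β m / n` exceed the entropy `2 + 2
log (n / m)`. Since `β ≤ log n`, the size `m` tends to infinity, and so the failure probability
`exp (-m)` tends to `0`.

Every `m`-joined graph on `n ≥ (3 Δ + 10) m` vertices contains, deterministically, all trees of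
maximum degree at most `Δ` on `n - (2 Δ + 4) m` vertices (`SimpleGraph.IsJoined.isContained`).
Large sets expand by joinedness; removing a maximum set of poor expansion, which has fewer than
`m` vertices, makes all small sets expand by the factor `Δ + 1`
(`SimpleGraph.IsJoined.exists_expanding_compl`). The tree is then embedded leaf by leaf, in the
manner of Friedman and Pippenger and of Haxell. During the embedding each vertex `x` reserves a
demand `w x` for further neighbours, and the invariant is that every set `U` of at most `2 m`
vertices has at least `∑ x ∈ U, w x` neighbours that are not yet used
(`SimpleGraph.IsExtendable`). Sets attaining equality are closed under union by submodularity, and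
have fewer than `m` vertices by joinedness; this is why some choice of the next leaf always keeps
the invariant (`SimpleGraph.IsExtendable.exists_adj`).
-/

/-! ### Neighbourhoods in graphs with an edge between any two large sets -/

/-- A graph is `m`-joined if there is an edge between any two disjoint sets of `m` vertices. -/
def SimpleGraph.IsJoined {V : Type*} (G : SimpleGraph V) (m : ℕ) : Prop :=
  ∀ A B : Finset V, A.card = m → B.card = m → Disjoint A B → ∃ a ∈ A, ∃ b ∈ B, G.Adj a b

open Classical in
/-- The set of all vertices with a neighbour in `U`; it may meet `U`. -/
noncomputable def SimpleGraph.nbhd {V : Type*} [Fintype V] (G : SimpleGraph V) (U : Finset V) :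
    Finset V :=
  {y | ∃ x ∈ U, G.Adj x y}

/-- The vertices of `W` are in use, and every vertex `x` still demands `w x` new neighbours of its
own. `(W, w)` is `m`-extendable if every set of at most `2 * m` vertices satisfies the Hall-type
condition that is necessary for meeting all demands outside `W`. -/
def SimpleGraph.IsExtendable {V : Type*} [Fintype V] [DecidableEq V] (G : SimpleGraph V) (m : ℕ)
    (W : Finset V) (w : V → ℕ) : Prop :=
  ∀ U : Finset V, U.card ≤ 2 * m → ∑ x ∈ U, w x ≤ (G.nbhd U \ W).card

namespace SimpleGraph

variable {V : Type*} [Fintype V] {G : SimpleGraph V} {m D : ℕ} {W U : Finset V} {w : V → ℕ}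

lemma mem_nbhd {y : V} : y ∈ G.nbhd U ↔ ∃ x ∈ U, G.Adj x y := by
  simp [nbhd]

lemma nbhd_mono {U' : Finset V} (h : U ⊆ U') : G.nbhd U ⊆ G.nbhd U' := fun y hy => by
  obtain ⟨x, hx, hxy⟩ := mem_nbhd.1 hy
  exact mem_nbhd.2 ⟨x, h hx, hxy⟩

variable [DecidableEq V]

lemma nbhd_union (U U' : Finset V) : G.nbhd (U ∪ U') = G.nbhd U ∪ G.nbhd U' := by
  ext y
  simp only [mem_nbhd, Finset.mem_union]
  grind

lemma IsJoined.card_lt_card_nbhd_sdiff (hJ : G.IsJoined m) (hU : m ≤ U.card) (W : Finset V) :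
    Fintype.card V < (G.nbhd U \ W).card + W.card + U.card + m := by
  have hlt : ((G.nbhd U ∪ U)ᶜ).card < m := by
    by_contra! h
    obtain ⟨A, hAU, hA⟩ := Finset.exists_subset_card_eq hU
    obtain ⟨B, hBU, hB⟩ := Finset.exists_subset_card_eq h
    obtain ⟨a, ha, b, hb, hab⟩ := hJ A B hA hB (by
      rw [Finset.disjoint_left]
      intro x hx hx'
      have := hBU hx'
      simp only [Finset.mem_compl, Finset.mem_union, not_or] at this
      exact this.2 (hAU hx))
    have := hBU hb
    simp only [Finset.mem_compl, Finset.mem_union, not_or] at this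
    exact this.1 (mem_nbhd.2 ⟨a, hAU ha, hab⟩)
  have h1 := Finset.card_add_card_compl (G.nbhd U ∪ U)
  have h2 := Finset.card_union_le (G.nbhd U) U
  have h3 := Finset.card_le_card_sdiff_add_card (s := G.nbhd U) (t := W)
  omega

/-! ### Extending a partial embedding by a leaf -/

/-- As `U ↦ #(N(U) \ W)` is submodular and the demand is modular, the sets that attain equality in
the extendability condition are closed under unions, as long as the union is not too large. -/
lemma IsExtendable.union_of_eq (hE : G.IsExtendable m W w) {U₁ U₂ : Finset V}
    (hU : U₁.card + U₂.card ≤ 2 * m) (h₁ : (G.nbhd U₁ \ W).card = ∑ x ∈ U₁, w x)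
    (h₂ : (G.nbhd U₂ \ W).card = ∑ x ∈ U₂, w x) :
    (G.nbhd (U₁ ∪ U₂) \ W).card = ∑ x ∈ U₁ ∪ U₂, w x := by
  have hle := hE (U₁ ∪ U₂) ((Finset.card_union_le _ _).trans hU)
  have hinter := hE (U₁ ∩ U₂) ((Finset.card_le_card Finset.inter_subset_left).trans (by omega))
  have hsum := Finset.sum_union_inter (s₁ := U₁) (s₂ := U₂) (f := w)
  have hcard := Finset.card_union_add_card_inter (G.nbhd U₁ \ W) (G.nbhd U₂ \ W)
  have hsub : G.nbhd (U₁ ∩ U₂) \ W ⊆ (G.nbhd U₁ \ W) ∩ (G.nbhd U₂ \ W) := by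
    intro y hy
    have h1 := nbhd_mono (G := G) (Finset.inter_subset_left (s₁ := U₁) (s₂ := U₂))
    have h2 := nbhd_mono (G := G) (Finset.inter_subset_right (s₁ := U₁) (s₂ := U₂))
    grind
  have := Finset.card_le_card hsub
  rw [nbhd_union, Finset.union_sdiff_distrib] at *
  omega

/-- Joinedness makes the extendability condition strict for large sets. -/
lemma IsJoined.card_lt_of_eq (hJ : G.IsJoined m) (hw : ∀ x, w x ≤ D)
    (hW : W.card + 2 * m * D + 3 * m ≤ Fintype.card V) (hU : U.card ≤ 2 * m)
    (h : (G.nbhd U \ W).card = ∑ x ∈ U, w x) : U.card < m := by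
  by_contra! hm
  have h1 := hJ.card_lt_card_nbhd_sdiff hm W
  have h2 : ∑ x ∈ U, w x ≤ U.card * D := by
    simpa using Finset.sum_le_card_nsmul U w D fun x _ => hw x
  have h3 : U.card * D ≤ 2 * m * D := Nat.mul_le_mul_right D hU
  omega

/-- If `s` still demands a neighbour, one of its unused neighbours can be taken for this purpose
without destroying extendability. Otherwise each unused neighbour `y` lies in the neighbourhood of
a set avoiding `s` that attains equality; the union of these sets attains equality as well, and
adding `s` to it raises the demand but not the number of unused neighbours. -/
theorem IsExtendable.exists_adj (hE : G.IsExtendable m W w) (hJ : G.IsJoined m) (hm : 0 < m)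
    (hw : ∀ x, w x ≤ D) (hW : W.card + 2 * m * D + 3 * m ≤ Fintype.card V) {s : V}
    (hs : 0 < w s) :
    ∃ y, G.Adj s y ∧ y ∉ W ∧
      G.IsExtendable m (insert y W) (Function.update w s (w s - 1)) := by
  by_contra! hcon
  have hbad : ∀ y, G.Adj s y → y ∉ W → ∃ U : Finset V, U.card < m ∧
      (G.nbhd U \ W).card = ∑ x ∈ U, w x ∧ s ∉ U ∧ y ∈ G.nbhd U := by
    intro y hsy hy
    have := hcon y hsy hy
    simp only [IsExtendable, not_forall, not_le] at this
    obtain ⟨U, hU, hlt⟩ := this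
    have hle := hE U hU
    have hins : G.nbhd U \ insert y W = (G.nbhd U \ W).erase y := by grind
    rw [hins] at hlt
    have hpred := Finset.pred_card_le_card_erase (s := G.nbhd U \ W) (a := y)
    have hsU : s ∉ U := by
      intro hsU
      rw [Finset.sum_update_of_mem hsU] at hlt
      have := Finset.add_sum_erase U w hsU
      rw [Finset.erase_eq] at this
      omega
    rw [Finset.sum_update_of_notMem hsU] at hlt
    have hyU : y ∈ G.nbhd U := by
      by_contra hyU
      rw [Finset.erase_eq_of_notMem (by simp [hyU])] at hlt
      omega
    have heq : (G.nbhd U \ W).card = ∑ x ∈ U, w x := by omega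
    exact ⟨U, hJ.card_lt_of_eq hw hW hU heq, heq, hsU, hyU⟩
  have hunion : ∀ Y : Finset V, Y ⊆ G.nbhd {s} \ W → ∃ U : Finset V, U.card < m ∧
      (G.nbhd U \ W).card = ∑ x ∈ U, w x ∧ s ∉ U ∧ Y ⊆ G.nbhd U := by
    intro Y
    induction Y using Finset.induction_on with
    | empty => exact fun _ => ⟨∅, by simpa using hm, by simp [nbhd], by simp, by simp⟩
    | insert y Y _ ih =>
      intro hY
      rw [Finset.insert_subset_iff] at hY
      obtain ⟨U₁, hc₁, he₁, hs₁, hY₁⟩ := ih hY.2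
      have hy := hY.1
      simp only [Finset.mem_sdiff, mem_nbhd, Finset.mem_singleton, exists_eq_left] at hy
      obtain ⟨U₂, hc₂, he₂, hs₂, hy₂⟩ := hbad y hy.1 hy.2
      have he := hE.union_of_eq (by omega) he₁ he₂
      refine ⟨U₁ ∪ U₂, hJ.card_lt_of_eq hw hW ?_ he, he, by simp [hs₁, hs₂], ?_⟩
      · exact (Finset.card_union_le _ _).trans (by omega)
      · rw [nbhd_union]
        grind
  obtain ⟨U, hc, he, hsU, hY⟩ := hunion _ subset_rfl
  have h1 := hE (insert s U) (by rw [Finset.card_insert_of_notMem hsU]; omega)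
  rw [Finset.sum_insert hsU, Finset.insert_eq, nbhd_union] at h1
  have h2 : (G.nbhd {s} ∪ G.nbhd U) \ W = G.nbhd U \ W := by grind
  rw [h2] at h1
  omega

/-! ### Discarding a set of poorly expanding vertices -/

/-- Among the sets of at most `3 * m` vertices that do not expand by the factor `D`, one of maximum
size is discarded. Joinedness shows that it has fewer than `m` vertices; by maximality, all small
sets in the remaining graph expand. -/
theorem IsJoined.exists_expanding_compl (hJ : G.IsJoined m)
    (hV : 3 * m * D + 7 * m ≤ Fintype.card V) :
    ∃ Z : Finset V, Z.card < m ∧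
      ∀ U : Finset V, U.card ≤ 2 * m → Disjoint U Z → D * U.card ≤ (G.nbhd U \ Z).card := by
  let S : Finset (Finset V) := {Z | Z.card ≤ 3 * m ∧ (G.nbhd Z \ Z).card ≤ D * Z.card}
  obtain ⟨Z, hZS, hmax⟩ := S.exists_max_image Finset.card
    ⟨∅, Finset.mem_filter.2 ⟨Finset.mem_univ _, by simp [nbhd]⟩⟩
  simp only [S, Finset.mem_filter, Finset.mem_univ, true_and] at hZS hmax
  have hZ : Z.card < m := by
    by_contra! h
    have h1 := hJ.card_lt_card_nbhd_sdiff h Z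
    have h2 : D * Z.card ≤ D * (3 * m) := Nat.mul_le_mul_left D hZS.1
    have h3 : D * (3 * m) = 3 * m * D := mul_comm _ _
    omega
  refine ⟨Z, hZ, fun U hU hUZ => ?_⟩
  by_contra! hlt
  have hcard : (U ∪ Z).card = U.card + Z.card := Finset.card_union_of_disjoint hUZ
  have hU0 : 0 < U.card := Nat.pos_of_ne_zero fun h => by simp [h] at hlt
  have hsub : G.nbhd (U ∪ Z) \ (U ∪ Z) ⊆ (G.nbhd U \ Z) ∪ (G.nbhd Z \ Z) := by
    rw [nbhd_union]
    grind
  have h1 := (Finset.card_le_card hsub).trans (Finset.card_union_le _ _)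
  have h2 := hmax (U ∪ Z) ⟨by omega, by rw [hcard, mul_add]; omega⟩
  omega

/-- The starting point of the embedding: the poorly expanding set `Z` is declared used and gets no
demand, a root is chosen outside `Z`, and every vertex outside `Z` demands `Δ` neighbours. The
factor `Δ + 1` in the expansion makes up for the root. -/
theorem IsJoined.exists_isExtendable {Δ : ℕ} (hJ : G.IsJoined m)
    (hV : 3 * m * (Δ + 1) + 7 * m ≤ Fintype.card V) (hm : 0 < m) :
    ∃ (Z : Finset V) (v : V) (w : V → ℕ), Z.card < m ∧ v ∉ Z ∧ (∀ x, w x ≤ Δ) ∧ (∀ x ∉ Z, w x = Δ) ∧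
      G.IsExtendable m (insert v Z) w := by
  obtain ⟨Z, hZ, hexp⟩ := hJ.exists_expanding_compl hV
  obtain ⟨v, hv⟩ : ∃ v, v ∉ Z := by
    by_contra! h
    have := Finset.card_le_card (fun x _ => h x : (Finset.univ : Finset V) ⊆ Z)
    rw [Finset.card_univ] at this
    omega
  refine ⟨Z, v, fun x => if x ∈ Z then 0 else Δ, hZ, hv,
    fun x => by beta_reduce; split_ifs <;> omega, fun x hx => if_neg hx, fun U hU => ?_⟩
  have hsum : ∑ x ∈ U, (if x ∈ Z then 0 else Δ) = (U \ Z).card * Δ := by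
    rw [Finset.sum_ite, Finset.sum_const_zero, zero_add, Finset.sum_const, smul_eq_mul,
      Finset.sdiff_eq_filter]
  have hexp' := hexp (U \ Z) ((Finset.card_le_card Finset.sdiff_subset).trans hU)
    Finset.sdiff_disjoint
  have hsub : (G.nbhd (U \ Z) \ Z).erase v ⊆ G.nbhd U \ insert v Z := by
    have := nbhd_mono (G := G) (Finset.sdiff_subset (s := U) (t := Z))
    grind
  have h1 := (Finset.pred_card_le_card_erase (s := G.nbhd (U \ Z) \ Z) (a := v)).trans
    (Finset.card_le_card hsub)
  rw [hsum]
  rw [add_mul, one_mul, mul_comm] at hexp'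
  rcases Nat.eq_zero_or_pos (U \ Z).card with h0 | h0
  · simp [h0]
  · omega

/-! ### Embedding bounded-degree trees leaf by leaf -/

/-- A tree on `k + 2` vertices arises from a tree on `k + 1` vertices by joining a new vertex `v`
to an old vertex `u`. -/
lemma IsTree.exists_leaf {α : Type*} [Fintype α] {T : SimpleGraph α} (hT : T.IsTree) {k : ℕ}
    (hk : Fintype.card α = k + 2) :
    ∃ v : α, (T.induce {v}ᶜ).IsTree ∧ ∃ u, T.Adj v u ∧ ∀ u', T.Adj v u' → u' = u := by
  classical
  have : Nontrivial α := Fintype.one_lt_card_iff_nontrivial.1 (by omega)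
  obtain ⟨v, hv⟩ := hT.exists_vert_degree_one_of_nontrivial
  exact ⟨v, ⟨hT.connected.induce_compl_singleton_of_degree_eq_one hv, hT.isAcyclic.induce _⟩,
    degree_eq_one_iff_existsUnique_adj.1 hv⟩

/-- The embedding of a tree, by induction on its number of vertices. The image of `a` has given up
one unit of its demand `Δ` for at most each edge at `a`; so it can still serve the edges at `a`
in a larger tree of maximum degree at most `Δ`. -/
theorem IsExtendable.exists_embedding {Δ : ℕ} {Z : Finset V} {v₀ : V} (hJ : G.IsJoined m)
    (hm : 0 < m) (hE : G.IsExtendable m (insert v₀ Z) w) (hv₀ : v₀ ∉ Z)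
    (hw : ∀ x, w x ≤ Δ) (hwZ : ∀ x ∉ Z, w x = Δ)
    (k : ℕ) (hk : Z.card + k + 1 + 2 * m * Δ + 3 * m ≤ Fintype.card V)
    {α : Type} [Fintype α] {T : SimpleGraph α} (hT : T.IsTree) (hα : Fintype.card α = k + 1)
    (hΔ : ∀ a, (T.neighborSet a).ncard ≤ Δ) :
    ∃ (f : α → V) (w' : V → ℕ), Function.Injective f ∧ (∀ a b, T.Adj a b → G.Adj (f a) (f b)) ∧
      (∀ x, w' x ≤ Δ) ∧ (∀ x ∉ Z ∪ Finset.univ.image f, w' x = Δ) ∧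
      (∀ a, Δ ≤ w' (f a) + (T.neighborSet a).ncard) ∧
      G.IsExtendable m (Z ∪ Finset.univ.image f) w' := by
  classical
  induction k generalizing α with
  | zero =>
    have hsub : Subsingleton α := Fintype.card_le_one_iff_subsingleton.1 hα.le
    obtain ⟨a₀⟩ : Nonempty α := Fintype.card_pos_iff.1 (by omega)
    refine ⟨fun _ => v₀, w, fun a b _ => Subsingleton.elim a b, fun a b hab =>
      (hab.ne (Subsingleton.elim a b)).elim, hw,
      fun x hx => hwZ x fun h => hx (Finset.mem_union_left _ h),
      fun a => by simp [hwZ v₀ hv₀], ?_⟩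
    rwa [Finset.image_const ⟨a₀, Finset.mem_univ a₀⟩, Finset.union_comm, ← Finset.insert_eq]
  | succ k ih =>
    obtain ⟨v, hT', u, hvu, huniq⟩ := hT.exists_leaf hα
    have hcard : Fintype.card ({v}ᶜ : Set α) = k + 1 := by
      rw [Fintype.card_compl_set, hα]
      simp
    have himage : ∀ a : ({v}ᶜ : Set α), Subtype.val '' ((T.induce {v}ᶜ).neighborSet a) =
        T.neighborSet a \ {v} := by
      intro a
      ext b
      simp
    have hdeg : ∀ a : ({v}ᶜ : Set α), ((T.induce {v}ᶜ).neighborSet a).ncard =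
        (T.neighborSet a \ {v}).ncard := fun a => by
      rw [← himage, Set.ncard_image_of_injective _ Subtype.val_injective]
    have hdegle : ∀ a : ({v}ᶜ : Set α), ((T.induce {v}ᶜ).neighborSet a).ncard ≤
        (T.neighborSet a).ncard := fun a => by
      rw [hdeg]
      exact Set.ncard_le_ncard Set.sdiff_subset
    obtain ⟨f, w', hf, hadj, hw', hunused, hdem, hE'⟩ := ih (by omega) hT' hcard
      fun a => (hdegle a).trans (hΔ a)
    have huv : u ≠ v := hvu.ne'
    let u' : ({v}ᶜ : Set α) := ⟨u, huv⟩
    have hdegu : ((T.induce {v}ᶜ).neighborSet u').ncard + 1 = (T.neighborSet u).ncard := by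
      rw [hdeg]
      exact Set.ncard_sdiff_singleton_add_one hvu.symm
    have hpos : 0 < w' (f u') := by
      have := hdem u'
      have := hΔ u
      omega
    have hWcard : (Z ∪ Finset.univ.image f).card ≤ Z.card + (k + 1) :=
      (Finset.card_union_le _ _).trans
        (Nat.add_le_add_left (Finset.card_image_le.trans_eq (by rw [Finset.card_univ, hcard])) _)
    obtain ⟨y, hy, hyW, hEy⟩ := hE'.exists_adj hJ hm hw' (by omega) hpos
    have hyf : ∀ a, f a ≠ y := fun a ha => hyW (by simp [← ha])
    let g : α → V := fun a => if h : a = v then y else f ⟨a, h⟩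
    have hgv : g v = y := by simp [g]
    have hg : ∀ a (h : a ≠ v), g a = f ⟨a, h⟩ := fun a h => by simp [g, h]
    have hadjv : ∀ b, T.Adj v b → G.Adj (g v) (g b) := by
      intro b hb
      rw [huniq b hb, hgv, hg u huv]
      exact hy.symm
    have himg : insert y (Z ∪ Finset.univ.image f) = Z ∪ Finset.univ.image g := by
      ext x
      simp only [Finset.mem_insert, Finset.mem_union, Finset.mem_image, Finset.mem_univ,
        true_and]
      constructor
      · rintro (rfl | h | ⟨a, rfl⟩)
        · exact Or.inr ⟨v, hgv⟩
        · exact Or.inl h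
        · exact Or.inr ⟨a, hg a a.2⟩
      · rintro (h | ⟨a, rfl⟩)
        · exact Or.inr (Or.inl h)
        · by_cases ha : a = v
          · exact Or.inl (by rw [ha, hgv])
          · exact Or.inr (Or.inr ⟨_, (hg a ha).symm⟩)
    refine ⟨g, Function.update w' (f u') (w' (f u') - 1), ?_, ?_, ?_, ?_, ?_, ?_⟩
    · intro a b hab
      by_cases ha : a = v <;> by_cases hb : b = v
      · rw [ha, hb]
      · rw [ha, hgv, hg b hb] at hab
        exact (hyf _ hab.symm).elim
      · rw [hb, hgv, hg a ha] at hab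
        exact (hyf _ hab).elim
      · rw [hg a ha, hg b hb] at hab
        exact congrArg Subtype.val (hf hab)
    · intro a b hab
      by_cases ha : a = v
      · subst ha
        exact hadjv b hab
      by_cases hb : b = v
      · subst hb
        exact (hadjv a hab.symm).symm
      rw [hg a ha, hg b hb]
      exact hadj _ _ hab
    · intro x
      rw [Function.update_apply]
      split_ifs
      · have := hw' (f u')
        omega
      · exact hw' x
    · intro x hx
      rw [← himg, Finset.mem_insert, not_or] at hx
      rw [Function.update_of_ne, hunused x hx.2]
      rintro rfl
      exact hx.2 (by simp)
    · intro a
      by_cases ha : a = v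
      · have hdegv : 0 < (T.neighborSet v).ncard :=
          (Set.ncard_pos (Set.toFinite _)).2 ⟨u, hvu⟩
        rw [ha, hgv, Function.update_of_ne (hyf u').symm, hunused y hyW]
        omega
      rw [hg a ha]
      by_cases hau : a = u
      · subst hau
        rw [Function.update_self]
        have := hdem u'
        omega
      · rw [Function.update_of_ne fun h => hau (congrArg Subtype.val (hf h))]
        exact (hdem ⟨a, ha⟩).trans (Nat.add_le_add_left (hdegle _) _)
    · rwa [← himg]

/-- An `m`-joined graph on `n` vertices contains all trees of maximum degree at most `Δ` on
`n - O(Δ m)` vertices. -/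
theorem IsJoined.isContained {Δ : ℕ} (hJ : G.IsJoined m) (hm : 0 < m)
    (hV : 3 * m * (Δ + 1) + 7 * m ≤ Fintype.card V) {α : Type} [Fintype α] {T : SimpleGraph α}
    [DecidableRel T.Adj] (hT : T.IsTree) (hΔ : T.maxDegree ≤ Δ)
    (hα : Fintype.card α + 2 * m * Δ + 4 * m ≤ Fintype.card V) : T.IsContained G := by
  have := hT.connected.nonempty
  have hpos : 0 < Fintype.card α := Fintype.card_pos
  obtain ⟨Z, v, w, hZ, hv, hw, hwZ, hE⟩ := hJ.exists_isExtendable hV hm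
  obtain ⟨f, -, hf, hadj, -⟩ := hE.exists_embedding hJ hm hv hw hwZ (Fintype.card α - 1)
    (by omega) hT (by omega) fun a => by
      rw [Set.ncard_eq_toFinset_card', ← neighborFinset_def, card_neighborFinset_eq_degree]
      exact (T.degree_le_maxDegree a).trans hΔ
  exact ⟨⟨⟨f, fun {a b} h => hadj a b h⟩, hf⟩⟩

end SimpleGraph

/-! ### The random graph is joined -/
namespace SimpleGraph
open MeasureTheory ProbabilityTheory

/-- All potential edges in `F` are absent with probability `(1 - p) ^ #F`; only the upper bound is
needed. -/
lemma binomialRandom_forall_notMem_le {V : Type*} [Countable V] (p : unitInterval)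
    (F : Finset (Sym2 V)) (hF : ∀ e ∈ F, ¬ e.IsDiag) :
    binomialRandom V p {G | ∀ e ∈ F, e ∉ G.edgeSet} ≤ ENNReal.ofReal ((1 - p) ^ F.card) := by
  rw [binomialRandom_apply]
  calc _ ≤ Measure.infinitePi (fun e : Sym2 V ↦ unitInterval.toNNReal p • Measure.dirac (¬ e.IsDiag)
            + unitInterval.toNNReal (unitInterval.symm p) • Measure.dirac False)
          (Set.pi F fun _ => {False}) := by
        refine measure_mono ?_
        rintro _ ⟨G, hG, rfl⟩ e he
        simpa using hG e he
    _ = ∏ e ∈ F, ENNReal.ofReal (1 - p) := by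
        rw [Measure.infinitePi_pi _ (fun _ _ => MeasurableSet.of_discrete)]
        refine Finset.prod_congr rfl fun e he => ?_
        have hσ : (unitInterval.toNNReal (unitInterval.symm p) : ENNReal) =
            ENNReal.ofReal (1 - p) := (ENNReal.ofReal_eq_coe_nnreal _).symm
        simp [hF e he, hσ]
    _ = _ := by
        rw [Finset.prod_const, ENNReal.ofReal_pow (by linarith [p.2.2])]

/-- The union bound over all pairs of disjoint `m`-sets. -/
lemma binomialRandom_not_isJoined_le (V : Type*) [Fintype V] (p : unitInterval) (m : ℕ) :
    binomialRandom V p {G | ¬ G.IsJoined m} ≤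
      ENNReal.ofReal (((Fintype.card V).choose m : ℝ) ^ 2 * (1 - p) ^ (m ^ 2)) := by
  classical
  let S : Finset (Finset V × Finset V) :=
    (Finset.univ.powersetCard m ×ˢ Finset.univ.powersetCard m).filter fun q => Disjoint q.1 q.2
  let F : Finset V × Finset V → Finset (Sym2 V) := fun q => (q.1 ×ˢ q.2).image fun x => s(x.1, x.2)
  have hS : ∀ q ∈ S, q.1.card = m ∧ q.2.card = m ∧ Disjoint q.1 q.2 := fun q hq => by
    simp only [S, Finset.mem_filter, Finset.mem_product, Finset.mem_powersetCard] at hq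
    exact ⟨hq.1.1.2, hq.1.2.2, hq.2⟩
  have hF : ∀ q ∈ S, (F q).card = m ^ 2 := fun q hq => by
    obtain ⟨h1, h2, h3⟩ := hS q hq
    rw [Finset.card_image_of_injOn, Finset.card_product, h1, h2, sq]
    rintro ⟨a, b⟩ hab ⟨c, d⟩ hcd h
    simp only [Finset.coe_product, Set.mem_prod, Finset.mem_coe] at hab hcd
    rw [Finset.disjoint_left] at h3
    simp only [Sym2.eq_iff] at h
    grind
  have hdiag : ∀ q ∈ S, ∀ e ∈ F q, ¬ e.IsDiag := fun q hq e he => by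
    obtain ⟨-, -, h3⟩ := hS q hq
    obtain ⟨⟨a, b⟩, hab, rfl⟩ := Finset.mem_image.1 he
    rw [Finset.mem_product] at hab
    rw [Sym2.mk_isDiag_iff]
    intro h
    exact Finset.disjoint_left.1 h3 hab.1 (h ▸ hab.2)
  have hsub : {G : SimpleGraph V | ¬ G.IsJoined m} ⊆
      ⋃ q ∈ S, {G : SimpleGraph V | ∀ e ∈ F q, e ∉ G.edgeSet} := by
    intro G hG
    simp only [Set.mem_ofPred_eq, IsJoined, not_forall, not_exists, not_and] at hG
    obtain ⟨A, B, hA, hB, hAB, hno⟩ := hG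
    simp only [Set.mem_iUnion]
    refine ⟨(A, B), by simp [S, hA, hB, hAB], fun e he => ?_⟩
    obtain ⟨⟨a, b⟩, hab, rfl⟩ := Finset.mem_image.1 he
    rw [Finset.mem_product] at hab
    exact hno a hab.1 b hab.2
  have hp : (0 : ℝ) ≤ 1 - p := by linarith [p.2.2]
  have hcard : S.card ≤ (Fintype.card V).choose m ^ 2 := by
    refine (Finset.card_filter_le _ _).trans ?_
    rw [Finset.card_product, Finset.card_powersetCard, Finset.card_univ, sq]
  calc _ ≤ ∑ q ∈ S, binomialRandom V p {G | ∀ e ∈ F q, e ∉ G.edgeSet} :=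
        (measure_mono hsub).trans (measure_biUnion_finset_le _ _)
    _ ≤ ∑ q ∈ S, ENNReal.ofReal ((1 - p) ^ (m ^ 2)) :=
        Finset.sum_le_sum fun q hq =>
          (binomialRandom_forall_notMem_le p (F q) (hdiag q hq)).trans_eq (by rw [hF q hq])
    _ = ENNReal.ofReal (S.card * (1 - p) ^ (m ^ 2)) := by
        rw [Finset.sum_const, nsmul_eq_mul, ENNReal.ofReal_mul (by positivity),
          ENNReal.ofReal_natCast]
    _ ≤ _ := by
        gcongr
        exact_mod_cast hcard

/-- Since `n.choose m ≤ (e n / m) ^ m`, the union bound is exponentially small in `m` as soon as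
`p m` exceeds `3 + 2 log (n / m)`. -/
lemma choose_sq_mul_pow_le {n m : ℕ} {p : ℝ} (hm : 0 < m) (hn : 0 < n) (hp : p ≤ 1)
    (h : 3 + 2 * Real.log (n / m) ≤ p * m) :
    (n.choose m : ℝ) ^ 2 * (1 - p) ^ (m ^ 2) ≤ Real.exp (-m) := by
  have hm' : (0 : ℝ) < m := by exact_mod_cast hm
  have hn' : (0 : ℝ) < n := by exact_mod_cast hn
  have hchoose : (n.choose m : ℝ) ≤ Real.exp (m * (1 + Real.log (n / m))) :=
    calc (n.choose m : ℝ) ≤ n ^ m / m.factorial := Nat.choose_le_pow_div m n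
      _ = (n / m) ^ m * (m ^ m / m.factorial) := by
          rw [div_pow]
          field_simp
      _ ≤ (n / m) ^ m * Real.exp m := by
          gcongr
          exact Real.pow_div_factorial_le_exp m hm'.le m
      _ = _ := by
          rw [mul_add, mul_one, Real.exp_add, Real.exp_nat_mul, Real.exp_log (by positivity),
            mul_comm]
  have hexp : (1 - p) ^ (m ^ 2) ≤ Real.exp (-(p * m * m)) :=
    calc (1 - p) ^ (m ^ 2) ≤ Real.exp (-p) ^ (m ^ 2) :=
          pow_le_pow_left₀ (by linarith) (Real.one_sub_le_exp_neg p) _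
      _ = _ := by
          rw [← Real.exp_nat_mul]
          push_cast
          ring_nf
  calc (n.choose m : ℝ) ^ 2 * (1 - p) ^ (m ^ 2)
      ≤ Real.exp (m * (1 + Real.log (n / m))) ^ 2 * Real.exp (-(p * m * m)) := by
        gcongr
    _ = Real.exp (-m + m * (3 + 2 * Real.log (n / m) - p * m)) := by
        rw [← Real.exp_nat_mul, ← Real.exp_add]
        push_cast
        ring_nf
    _ ≤ Real.exp (-m) := by
        gcongr
        have : m * (3 + 2 * Real.log (n / m) - p * m) ≤ 0 :=
          mul_nonpos_of_nonneg_of_nonpos hm'.le (by linarith)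
        linarith

end SimpleGraph

/-! ### Choice of the parameters -/

/-- The size of the sets between which `G(n, β / n)` has edges: about `δ n / K`. It grows with `n`,
and the edge density beats the entropy `2 log (n / m)` of a pair of `m`-sets. -/
lemma exists_joined_size {K C β δ : ℝ} {n : ℕ} (hK : 1 ≤ K)
    (hC : C = 4 * K * (8 + 4 * Real.log (2 * K))) (hn : 0 < n) (hβ : 0 < β)
    (hβn : β ≤ Real.log n) (hδ : 0 < δ) (hδ2 : δ ≤ 1 / 2) (h : C / 2 * Real.log (1 / δ) ≤ β * δ) :
    ∃ m : ℕ, 0 < m ∧ Nat.sqrt n ≤ m ∧ K * m ≤ δ * n ∧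
      3 + 2 * Real.log (n / m) ≤ β / n * m := by
  have hn' : (0 : ℝ) < n := by exact_mod_cast hn
  have hK0 : 0 < K := by linarith
  have hL : 0 ≤ Real.log (2 * K) := Real.log_nonneg (by linarith)
  have hlog : 1 / 2 ≤ Real.log (1 / δ) := by
    have h1 : (2 : ℝ) ≤ 1 / δ := by
      rw [le_div_iff₀ hδ]
      linarith
    have := Real.log_le_log two_pos h1
    linarith [Real.log_two_gt_d9]
  have hC32 : 32 * K ≤ C := by
    rw [hC]
    nlinarith
  -- The lower bound on `β δ` and `β ≤ log n ≤ 2 √n` give `δ n ≥ K √n`.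
  have hsqrt : √(n : ℝ) ≤ δ * n / K := by
    have hs : 0 < √(n : ℝ) := Real.sqrt_pos.2 hn'
    have hss : √(n : ℝ) * √(n : ℝ) = n := Real.mul_self_sqrt hn'.le
    have h1 : Real.log n ≤ 2 * √(n : ℝ) := by
      have := Real.log_le_sub_one_of_pos hs
      rw [Real.log_sqrt hn'.le] at this
      linarith
    have h2 : 8 * K ≤ 2 * √(n : ℝ) * δ :=
      calc 8 * K ≤ C / 2 * (1 / 2) := by linarith
        _ ≤ C / 2 * Real.log (1 / δ) := by gcongr; linarith
        _ ≤ β * δ := h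
        _ ≤ 2 * √(n : ℝ) * δ := by gcongr; linarith
    rw [le_div_iff₀ hK0]
    calc √(n : ℝ) * K ≤ √(n : ℝ) * (√(n : ℝ) * δ) := by gcongr; linarith
      _ = δ * n := by rw [← mul_assoc, hss, mul_comm]
  have hfloor : Nat.sqrt n ≤ ⌊δ * n / K⌋₊ :=
    Nat.le_floor ((Real.nat_sqrt_le_real_sqrt).trans hsqrt)
  have hpos : 0 < ⌊δ * n / K⌋₊ := (Nat.sqrt_pos.2 hn).trans_le hfloor
  set m := ⌊δ * n / K⌋₊ with hm
  have hm1 : (1 : ℝ) ≤ m := by exact_mod_cast hpos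
  have hle : m ≤ δ * n / K := Nat.floor_le (by positivity)
  have hlt : δ * n / K < 2 * m := (Nat.lt_floor_add_one _).trans_le (by linarith)
  rw [le_div_iff₀ hK0] at hle
  rw [div_lt_iff₀ hK0] at hlt
  refine ⟨m, hpos, hfloor, by linarith, ?_⟩
  have hnm : Real.log (n / m) ≤ Real.log (2 * K) + Real.log (1 / δ) := by
    rw [← Real.log_mul (by positivity) (by positivity)]
    refine Real.log_le_log (by positivity) ?_
    rw [mul_one_div, div_le_div_iff₀ (by linarith) hδ]
    linarith
  calc 3 + 2 * Real.log (n / m) ≤ (8 + 4 * Real.log (2 * K)) * Real.log (1 / δ) := by nlinarith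
    _ = C / 2 * Real.log (1 / δ) / (2 * K) := by
        rw [hC]
        field_simp
        ring
    _ ≤ β * δ / (2 * K) := by gcongr
    _ ≤ β / n * m := by
        rw [div_mul_eq_mul_div, div_le_div_iff₀ (by positivity) hn']
        have := mul_le_mul_of_nonneg_left hlt.le hβ.le
        linarith

/-- The bound for a single `n`. For `ε > 1 / 2`, the case `ε = 1 / 2` is stronger. -/
lemma one_sub_exp_le_gnp {Δ : ℕ} {K C β ε : ℝ} {n : ℕ} (hK : K = 3 * Δ + 10)
    (hC : C = 4 * K * (8 + 4 * Real.log (2 * K))) (hn : 0 < n) (hβ : 0 < β)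
    (hβn : β ≤ Real.log n) (hε : 0 < ε) (h : C / ε * Real.log (1 / ε) ≤ β) (hCβ : C ≤ β) :
    1 - ENNReal.ofReal (Real.exp (-Nat.sqrt n)) ≤
      gnp n (β / n) {G | ContainsBoundedDegreeTrees G Δ ((1 - ε) * n)} := by
  have hn' : (0 : ℝ) < n := by exact_mod_cast hn
  have hK1 : 1 ≤ K := by
    rw [hK]
    linarith [(Nat.cast_nonneg Δ : (0 : ℝ) ≤ Δ)]
  have hC0 : 0 < C := by
    have : 0 ≤ Real.log (2 * K) := Real.log_nonneg (by linarith)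
    rw [hC]
    positivity
  obtain ⟨δ, hδ, hδε, hδ2, hβδ⟩ : ∃ δ : ℝ, 0 < δ ∧ δ ≤ ε ∧ δ ≤ 1 / 2 ∧
      C / 2 * Real.log (1 / δ) ≤ β * δ := by
    rcases le_total ε (1 / 2) with hε2 | hε2
    · refine ⟨ε, hε, le_rfl, hε2, ?_⟩
      have hlog : 0 ≤ Real.log (1 / ε) := Real.log_nonneg (by
        rw [le_div_iff₀ hε]
        linarith)
      rw [div_mul_eq_mul_div, div_le_iff₀ hε] at h
      nlinarith
    · refine ⟨1 / 2, by norm_num, hε2, le_rfl, ?_⟩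
      rw [one_div_one_div]
      nlinarith [Real.log_two_lt_d9]
  obtain ⟨m, hm, hnm, hKm, hent⟩ := exists_joined_size hK1 hC hn hβ hβn hδ hδ2 hβδ
  have hp : β / n ∈ Set.Icc (0 : ℝ) 1 := by
    refine ⟨by positivity, ?_⟩
    rw [div_le_one hn']
    linarith [Real.log_le_sub_one_of_pos hn']
  have hsub : {G : SimpleGraph (Fin n) | ContainsBoundedDegreeTrees G Δ ((1 - ε) * n)}ᶜ ⊆
      {G | ¬ G.IsJoined m} := by
    intro G hG hJ
    refine hG fun k T _ hT hΔ hk => ?_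
    have hkn : (k : ℝ) + K * m ≤ n := by
      have := mul_le_mul_of_nonneg_right hδε hn'.le
      linarith
    rw [hK] at hkn
    have hkn' : k + (3 * Δ + 10) * m ≤ n := by exact_mod_cast hkn
    refine hJ.isContained hm ?_ hT hΔ ?_ <;> simp only [Fintype.card_fin] <;> nlinarith
  have hbad := SimpleGraph.binomialRandom_not_isJoined_le (Fin n) ⟨β / n, hp⟩ m
  rw [Fintype.card_fin] at hbad
  rw [gnp, Set.projIcc_of_mem _ hp, tsub_le_iff_right,
    ← MeasureTheory.measure_univ (μ := SimpleGraph.binomialRandom (Fin n) ⟨β / n, hp⟩),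
    ← Set.union_compl_self {G | ContainsBoundedDegreeTrees G Δ ((1 - ε) * n)}]
  refine (MeasureTheory.measure_union_le _ _).trans ?_
  gcongr
  refine (MeasureTheory.measure_mono hsub).trans (hbad.trans (ENNReal.ofReal_le_ofReal ?_))
  refine (SimpleGraph.choose_sq_mul_pow_le hm hn hp.2 hent).trans ?_
  gcongr

theorem mainTheorem5 (Δ : ℕ) (hΔ : 2 ≤ Δ) :
    ∃ C : ℝ, 0 < C ∧
      ∀ β ε : ℕ → ℝ,
        (∀ᶠ n : ℕ in Filter.atTop, 0 < β n ∧ β n ≤ Real.log n) →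
        (∀ᶠ n : ℕ in Filter.atTop, 0 < ε n) →
        (∀ᶠ n : ℕ in Filter.atTop, C / ε n * Real.log (1 / ε n) ≤ β n) →
        (∀ᶠ n : ℕ in Filter.atTop, C ≤ β n) →
        HoldsAAS (fun n => gnp n (β n / n))
          (fun n G => ContainsBoundedDegreeTrees G Δ ((1 - ε n) * n)) := by
  have hL : 0 ≤ Real.log (2 * (3 * (Δ : ℝ) + 10)) :=
    Real.log_nonneg (by linarith [(Nat.cast_nonneg Δ : (0 : ℝ) ≤ Δ)])
  refine ⟨4 * (3 * Δ + 10) * (8 + 4 * Real.log (2 * (3 * Δ + 10))), by positivity,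
    fun β ε hβ hε h hCβ => ?_⟩
  have hlim : Filter.Tendsto (fun n : ℕ => 1 - ENNReal.ofReal (Real.exp (-Nat.sqrt n)))
      Filter.atTop (nhds 1) := by
    have hsqrt : Filter.Tendsto Nat.sqrt Filter.atTop Filter.atTop :=
      Filter.tendsto_atTop_atTop.2 fun b => ⟨b * b, fun n hn => Nat.le_sqrt.2 hn⟩
    have hexp : Filter.Tendsto (fun n : ℕ => ENNReal.ofReal (Real.exp (-Nat.sqrt n)))
        Filter.atTop (nhds 0) := by
      have := ENNReal.tendsto_ofReal
        (Real.tendsto_exp_neg_atTop_nhds_zero.comp (tendsto_natCast_atTop_atTop.comp hsqrt))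
      simpa using this
    have := ENNReal.Tendsto.sub (tendsto_const_nhds (x := (1 : ENNReal))) hexp
      (Or.inl ENNReal.one_ne_top)
    simpa using this
  refine tendsto_of_tendsto_of_tendsto_of_le_of_le' hlim tendsto_const_nhds ?_ ?_
  · filter_upwards [hβ, hε, h, hCβ, Filter.eventually_gt_atTop 0] with n hβ hε h hCβ hn
    exact one_sub_exp_le_gnp rfl rfl hn hβ.1 hβ.2 hε h hCβ
  · refine Filter.Eventually.of_forall fun n => ?_
    simp only [gnp]
    exact MeasureTheory.prob_le_one
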